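/- Let $G$ be a locally compact (Hausdorff) group with left Haar measure $dg$, let $\lambda$ be its left regular representation on $L^2(G)$, $(\lambda(g)\xi)(h)=\xi(g^{-1}h)$, and let $L(G)=\{\lambda(g) : g\in G\}''$ be its group von Neumann algebra. The Fourier algebra $A(G)$ is the set of functions $g\mapsto\langle\lambda(g)\xi,\eta\rangle$ with $\xi,\eta\in L^2(G)$. Let $M_0A(G)$ be the space of completely bounded Fourier multipliers of $G$, that is, of functions $\varphi\colon G\to\mathbb{C}$ for which there is a (necessarily unique) normal completely bounded linear map $M_\varphi\colon L(G)\to L(G)$ with $M_\varphi(\lambda(g))=\varphi(g)\lambda(g)$ for all $g\in G$; its norm is $\|\varphi\|_{M_0A(G)}=\|M_\varphi\|_{\mathrm{cb}}$, and $A(G)\subset M_0A(G)$. The weak* topology on $M_0A(G)$ is the one given by its predual $M_0A(G)_*$, the completion of $L^1(G)$ in the norm $\|f\|=\sup\{|\int_G f(g)\varphi(g)\,dg| : \varphi\in M_0A(G),\ \|\varphi\|_{M_0A(G)}\le 1\}$. The group $G$ has the Approximation Property (AP) if there is a net in $A(G)$ that converges to the constant function $1$ in the weak* topology of $M_0A(G)$.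 It has property (T$^*$) if the (unique) left invariant mean $m$ on $M_0A(G)$ is weak* continuous; here a left invariant mean is a positive linear functional $m\colon M_0A(G)\to\mathbb{C}$ with $\|m\|=m(1)=1$ with respect to the supremum norm, such that $m(L_g\varphi)=m(\varphi)$ for all $g\in G$ and $\varphi\in M_0A(G)$, where $(L_g\varphi)(h)=\varphi(g^{-1}h)$. If $G$ has both the AP and property (T$^*$), then $G$ is compact. -/

import Mathlib

open MeasureTheory Filter Topology
open scoped ENNReal ComplexOrder

noncomputable section

namespace APObstruction

universe u

/-! ### The left regular representation and the group von Neumann algebra -/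

section Basic

variable (G : Type u) [Group G] [TopologicalSpace G] [IsTopologicalGroup G] [LocallyCompactSpace G]
  [MeasurableSpace G] [BorelSpace G]

/-- `L²(G)` with respect to the left Haar measure of `G`. -/
abbrev L2 : Type u := Lp ℂ 2 (Measure.haar : Measure G)

variable {G}

/-- The left regular representation, `(λ(g) ξ)(h) = ξ(g⁻¹ h)`. -/
def leftRegular (g : G) : L2 G →L[ℂ] L2 G :=
  (Lp.compMeasurePreservingₗᵢ ℂ (fun h : G => g⁻¹ * h)
    (measurePreserving_mul_left (Measure.haar : Measure G) g⁻¹)).toContinuousLinearMap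

theorem leftRegular_ae (g : G) (ξ : L2 G) :
    (leftRegular g ξ : G → ℂ) =ᵐ[Measure.haar] fun h => ξ (g⁻¹ * h) :=
  Lp.coeFn_compMeasurePreserving ξ (measurePreserving_mul_left (Measure.haar : Measure G) g⁻¹)

theorem leftRegular_one : leftRegular (1 : G) = 1 := by
  ext1 ξ
  refine Lp.ext ?_
  filter_upwards [leftRegular_ae 1 ξ] with h hh
  simpa using hh

theorem leftRegular_mul (g k : G) : leftRegular (g * k) = leftRegular g * leftRegular k := by
  ext1 ξ
  refine Lp.ext ?_
  have h1 := (measurePreserving_mul_left (Measure.haar : Measure G) g⁻¹).quasiMeasurePreserving.ae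
    (leftRegular_ae k ξ)
  filter_upwards [leftRegular_ae (g * k) ξ, leftRegular_ae g (leftRegular k ξ), h1] with h a b c
  rw [a, mul_apply_eq_comp, b, c]
  simp [mul_assoc]

theorem norm_leftRegular_apply (g : G) (ξ : L2 G) : ‖leftRegular g ξ‖ = ‖ξ‖ :=
  (Lp.compMeasurePreservingₗᵢ ℂ (fun h : G => g⁻¹ * h)
    (measurePreserving_mul_left (Measure.haar : Measure G) g⁻¹)).norm_map ξ

theorem star_leftRegular (g : G) : star (leftRegular g) = leftRegular g⁻¹ := by
  have h1 : star (leftRegular g) * leftRegular g = 1 := by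
    rw [ContinuousLinearMap.star_eq_adjoint]
    exact (ContinuousLinearMap.norm_map_iff_adjoint_comp_self _).1 (norm_leftRegular_apply g)
  have h2 : leftRegular g * leftRegular g⁻¹ = 1 := by
    rw [← leftRegular_mul, mul_inv_cancel, leftRegular_one]
  exact left_inv_eq_right_inv h1 h2

variable (G)

/-- The group von Neumann algebra `L(G)`, the bicommutant of `{λ(g) | g ∈ G}`. -/
def groupVN : VonNeumannAlgebra (L2 G) where
  toStarSubalgebra := StarSubalgebra.centralizer ℂ
    (StarSubalgebra.centralizer ℂ (Set.range (leftRegular (G := G))) : Set (L2 G →L[ℂ] L2 G))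
  centralizer_centralizer' := Set.centralizer_centralizer_centralizer _

/-- `L(G)` as a vector space. -/
abbrev LG : Type u := (groupVN G).toStarSubalgebra

variable {G}

theorem leftRegular_mem (g : G) : leftRegular g ∈ (groupVN G).toStarSubalgebra := by
  refine (StarSubalgebra.mem_centralizer_iff ℂ).2 fun T hT => ?_
  have h1 := ((StarSubalgebra.mem_centralizer_iff ℂ).1 hT (leftRegular g) ⟨g, rfl⟩).1
  have h2 := ((StarSubalgebra.mem_centralizer_iff ℂ).1 (star_mem hT) (leftRegular g) ⟨g, rfl⟩).1
  exact ⟨h1.symm, h2.symm⟩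

/-- `λ(g)` as an element of `L(G)`. -/
def leftRegularLG (g : G) : LG G := ⟨leftRegular g, leftRegular_mem g⟩

/-! ### The ultraweak topology and completely bounded maps -/

variable (G) in
/-- Square summable sequences in `L²(G)`. -/
abbrev SqSeq : Type u := lp (fun _ : ℕ => L2 G) 2

/-- The ultraweakly continuous functional `T ↦ ∑ₙ ⟨T ξₙ, ηₙ⟩` on `L(G)`, for square summable
sequences `ξ`, `η` in `L²(G)`. -/
def ultraweakFunctional (ξ η : SqSeq G) (T : LG G) : ℂ :=
  ∑' n, inner ℂ (η n) ((T : L2 G →L[ℂ] L2 G) (ξ n))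

variable (G) in
/-- The ultraweak (`σ`-weak) topology on `L(G)`. -/
@[reducible] def ultraweakTopology : TopologicalSpace (LG G) :=
  ⨅ (ξ : SqSeq G) (η : SqSeq G),
    TopologicalSpace.induced (ultraweakFunctional ξ η) inferInstance

/-- A map is normal if it is continuous for the ultraweak topology. -/
def IsNormalMap (M : LG G → LG G) : Prop :=
  Continuous[ultraweakTopology G, ultraweakTopology G] M

/-- The matrix norm on `M_n(L(G)) ⊆ M_n(B(L²(G))) = B(L²(G)ⁿ)`. -/
def matrixNorm {n : ℕ} (a : Matrix (Fin n) (Fin n) (LG G)) : ℝ :=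
  ‖CStarMatrix.ofMatrix (a.map fun T => (T : L2 G →L[ℂ] L2 G))‖

/-- `‖M‖_cb ≤ C`: all the amplifications `M ⊗ id : M_n(L(G)) → M_n(L(G))` have norm at most `C`. -/
def CBNormLE (M : LG G →ₗ[ℂ] LG G) (C : ℝ) : Prop :=
  ∀ (n : ℕ) (a : Matrix (Fin n) (Fin n) (LG G)), matrixNorm (a.map M) ≤ C * matrixNorm a

/-! ### Completely bounded Fourier multipliers -/

/-- `M` is the map `M_φ`: the normal linear map on `L(G)` with `λ(g) ↦ φ(g) λ(g)`. Since the span of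
the `λ(g)` is ultraweakly dense in `L(G)`, there is at most one such map for each `φ`. -/
structure IsMultiplierMap (φ : G → ℂ) (M : LG G →ₗ[ℂ] LG G) : Prop where
  normal : IsNormalMap M
  map_leftRegular : ∀ g, M (leftRegularLG g) = φ g • leftRegularLG g

/-- `φ` is a completely bounded multiplier with `‖M_φ‖_cb ≤ C`. -/
def MultiplierNormLE (φ : G → ℂ) (C : ℝ) : Prop :=
  0 ≤ C ∧ ∃ M : LG G →ₗ[ℂ] LG G, IsMultiplierMap φ M ∧ CBNormLE M C

theorem matrixNorm_nonneg {n : ℕ} (a : Matrix (Fin n) (Fin n) (LG G)) : 0 ≤ matrixNorm a :=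
  norm_nonneg _

theorem continuous_ultraweakFunctional (ξ η : SqSeq G) :
    Continuous[ultraweakTopology G, inferInstance] (ultraweakFunctional ξ η) :=
  continuous_iInf_dom (continuous_iInf_dom continuous_induced_dom)

theorem continuous_ultraweak_iff {X : Type*} (t : TopologicalSpace X) (f : X → LG G) :
    Continuous[t, ultraweakTopology G] f ↔
      ∀ ξ η : SqSeq G, Continuous (fun x => ultraweakFunctional ξ η (f x)) := by
  simp only [continuous_iInf_rng, continuous_induced_rng]
  rfl

theorem summable_norm_mul (ξ η : SqSeq G) : Summable fun n => ‖η n‖ * ‖ξ n‖ := by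
  have h1 := (lp.memℓp ξ).summable (by norm_num)
  have h2 := (lp.memℓp η).summable (by norm_num)
  have h (x : ℝ) : x ^ (2 : ℝ≥0∞).toReal = x ^ 2 := by norm_num
  simp only [h] at h1 h2
  refine Summable.of_nonneg_of_le (fun n => by positivity) (fun n => ?_) (h1.add h2)
  nlinarith [sq_nonneg (‖η n‖ - ‖ξ n‖), sq_nonneg ‖η n‖, sq_nonneg ‖ξ n‖]

theorem summable_ultraweak (ξ η : SqSeq G) (T : LG G) :
    Summable fun n => inner ℂ (η n) ((T : L2 G →L[ℂ] L2 G) (ξ n)) := by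
  refine Summable.of_norm_bounded
    ((summable_norm_mul ξ η).mul_left ‖(T : L2 G →L[ℂ] L2 G)‖) fun n => ?_
  refine (norm_inner_le_norm _ _).trans ?_
  have := (T : L2 G →L[ℂ] L2 G).le_opNorm (ξ n)
  nlinarith [norm_nonneg (η n)]

theorem ultraweakFunctional_add (ξ η : SqSeq G) (S T : LG G) :
    ultraweakFunctional ξ η (S + T) = ultraweakFunctional ξ η S + ultraweakFunctional ξ η T := by
  unfold ultraweakFunctional
  rw [← (summable_ultraweak ξ η S).tsum_add (summable_ultraweak ξ η T)]
  refine tsum_congr fun n => ?_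
  rw [← inner_add_right]
  rfl

theorem ultraweakFunctional_smul (ξ η : SqSeq G) (c : ℂ) (T : LG G) :
    ultraweakFunctional ξ η (c • T) = c * ultraweakFunctional ξ η T := by
  unfold ultraweakFunctional
  rw [← tsum_mul_left]
  refine tsum_congr fun n => ?_
  rw [← inner_smul_right]
  rfl

/-- `λ(g)` acting entrywise on square summable sequences. -/
def seqTranslate (g : G) (ξ : SqSeq G) : SqSeq G :=
  ⟨fun n => leftRegular g (ξ n), by
    refine memℓp_gen ?_
    simpa only [norm_leftRegular_apply] using (lp.memℓp ξ).summable (by norm_num)⟩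

theorem ultraweakFunctional_leftRegular_mul (ξ η : SqSeq G) (g : G) (T : LG G) :
    ultraweakFunctional ξ η (leftRegularLG g * T) =
      ultraweakFunctional ξ (seqTranslate g⁻¹ η) T := by
  unfold ultraweakFunctional
  refine tsum_congr fun n => ?_
  change inner ℂ (η n) (leftRegular g ((T : L2 G →L[ℂ] L2 G) (ξ n))) =
    inner ℂ (leftRegular g⁻¹ (η n)) ((T : L2 G →L[ℂ] L2 G) (ξ n))
  rw [← star_leftRegular, ContinuousLinearMap.star_eq_adjoint,
    ContinuousLinearMap.adjoint_inner_left]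

theorem IsNormalMap.comp {M N : LG G → LG G} (hM : IsNormalMap M) (hN : IsNormalMap N) :
    IsNormalMap (M ∘ N) :=
  @Continuous.comp _ _ _ (ultraweakTopology G) (ultraweakTopology G) (ultraweakTopology G)
    _ _ hM hN

theorem isNormalMap_leftRegular_mul (g : G) : IsNormalMap fun T : LG G => leftRegularLG g * T := by
  refine (continuous_ultraweak_iff _ _).2 fun ξ η => ?_
  simp only [ultraweakFunctional_leftRegular_mul]
  exact continuous_ultraweakFunctional _ _

theorem norm_diagonal_leftRegular_le (n : ℕ) (g : G) :
    ‖CStarMatrix.ofMatrix (Matrix.diagonal fun _ : Fin n => leftRegular g)‖ ≤ 1 := by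
  set D : CStarMatrix (Fin n) (Fin n) (L2 G →L[ℂ] L2 G) :=
    CStarMatrix.ofMatrix (Matrix.diagonal fun _ : Fin n => leftRegular g) with hD
  have h1 : star D * D = 1 := by
    have : (Matrix.diagonal fun _ : Fin n => leftRegular g).conjTranspose *
        (Matrix.diagonal fun _ : Fin n => leftRegular g) = 1 := by
      rw [Matrix.diagonal_conjTranspose, Matrix.diagonal_mul_diagonal, ← Matrix.diagonal_one]
      congr 1
      funext i
      rw [Pi.star_apply, star_leftRegular, ← leftRegular_mul, inv_mul_cancel, leftRegular_one]
    exact this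
  have h2 := CStarRing.norm_star_mul_self (x := D)
  have h3 := CStarRing.norm_star_mul_self
    (x := (1 : CStarMatrix (Fin n) (Fin n) (L2 G →L[ℂ] L2 G)))
  rw [h1] at h2
  rw [star_one, one_mul] at h3
  generalize ‖(1 : CStarMatrix (Fin n) (Fin n) (L2 G →L[ℂ] L2 G))‖ = x at h2 h3
  by_contra hD1
  push Not at hD1
  have hx : 1 < x := by nlinarith
  nlinarith

theorem matrixNorm_leftRegular_mul_le {n : ℕ} (g : G) (a : Matrix (Fin n) (Fin n) (LG G)) :
    matrixNorm (a.map fun T => leftRegularLG g * T) ≤ matrixNorm a := by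
  have h : CStarMatrix.ofMatrix ((a.map fun T => leftRegularLG g * T).map
        fun T => (T : L2 G →L[ℂ] L2 G)) =
      CStarMatrix.ofMatrix (Matrix.diagonal fun _ : Fin n => leftRegular g) *
        CStarMatrix.ofMatrix (a.map fun T => (T : L2 G →L[ℂ] L2 G)) := by
    have : ((a.map fun T => leftRegularLG g * T).map fun T => (T : L2 G →L[ℂ] L2 G)) =
        (Matrix.diagonal fun _ : Fin n => leftRegular g) *
          (a.map fun T => (T : L2 G →L[ℂ] L2 G)) := by
      ext1 i j
      rw [Matrix.diagonal_mul]
      rfl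
    rw [this]
    rfl
  unfold matrixNorm
  rw [h]
  refine (norm_mul_le _ _).trans ?_
  exact mul_le_of_le_one_left (norm_nonneg _) (norm_diagonal_leftRegular_le n g)

theorem MultiplierNormLE.one : MultiplierNormLE (1 : G → ℂ) 1 :=
  ⟨zero_le_one, LinearMap.id, ⟨@continuous_id _ (ultraweakTopology G), fun g => by simp⟩, fun n a => by
    rw [one_mul]; exact le_of_eq rfl⟩

theorem MultiplierNormLE.add {φ ψ : G → ℂ} {C D : ℝ} (hφ : MultiplierNormLE φ C)
    (hψ : MultiplierNormLE ψ D) : MultiplierNormLE (φ + ψ) (C + D) := by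
  obtain ⟨hC, M, hM, hMC⟩ := hφ
  obtain ⟨hD, N, hN, hND⟩ := hψ
  refine ⟨add_nonneg hC hD, M + N, ⟨?_, fun g => ?_⟩, fun n a => ?_⟩
  · refine (continuous_ultraweak_iff _ _).2 fun ξ η => ?_
    simp only [LinearMap.add_apply, ultraweakFunctional_add]
    exact @Continuous.add _ _ _ _ _ (ultraweakTopology G) _ _
      ((continuous_ultraweak_iff _ _).1 hM.normal ξ η)
      ((continuous_ultraweak_iff _ _).1 hN.normal ξ η)
  · rw [LinearMap.add_apply, hM.map_leftRegular, hN.map_leftRegular, Pi.add_apply, add_smul]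
  · rw [add_mul]
    exact (norm_add_le _ _).trans (add_le_add (hMC n a) (hND n a))

theorem MultiplierNormLE.smul {φ : G → ℂ} {C : ℝ} (c : ℂ) (hφ : MultiplierNormLE φ C) :
    MultiplierNormLE (c • φ) (‖c‖ * C) := by
  obtain ⟨hC, M, hM, hMC⟩ := hφ
  refine ⟨by positivity, c • M, ⟨?_, fun g => ?_⟩, fun n a => ?_⟩
  · refine (continuous_ultraweak_iff _ _).2 fun ξ η => ?_
    simp only [LinearMap.smul_apply, ultraweakFunctional_smul]
    exact @Continuous.mul _ _ _ _ _ (ultraweakTopology G) _ _ (@continuous_const _ _ (_) _ _)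
      ((continuous_ultraweak_iff _ _).1 hM.normal ξ η)
  · rw [LinearMap.smul_apply, hM.map_leftRegular, Pi.smul_apply, smul_assoc]
  · rw [mul_assoc]
    refine le_trans (le_of_eq ?_) (mul_le_mul_of_nonneg_left (hMC n a) (norm_nonneg c))
    exact norm_smul c (CStarMatrix.ofMatrix ((a.map M).map fun T => (T : L2 G →L[ℂ] L2 G)))

theorem MultiplierNormLE.translate {φ : G → ℂ} {C : ℝ} (g : G) (hφ : MultiplierNormLE φ C) :
    MultiplierNormLE (fun h => φ (g⁻¹ * h)) C := by
  obtain ⟨hC, M, hM, hMC⟩ := hφ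
  refine ⟨hC, LinearMap.mulLeft ℂ (leftRegularLG g) ∘ₗ M ∘ₗ
    LinearMap.mulLeft ℂ (leftRegularLG g⁻¹), ⟨?_, fun h => ?_⟩, fun n a => ?_⟩
  · exact (isNormalMap_leftRegular_mul g).comp
      (hM.normal.comp (isNormalMap_leftRegular_mul g⁻¹))
  · have h1 (a b : G) : leftRegularLG a * leftRegularLG b = leftRegularLG (a * b) :=
      Subtype.ext (leftRegular_mul a b).symm
    simp only [LinearMap.comp_apply, LinearMap.mulLeft_apply, h1, hM.map_leftRegular,
      mul_smul_comm, mul_inv_cancel_left]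
  · refine (matrixNorm_leftRegular_mul_le g
      ((a.map fun T => leftRegularLG g⁻¹ * T).map M)).trans ((hMC n _).trans ?_)
    exact mul_le_mul_of_nonneg_left (matrixNorm_leftRegular_mul_le g⁻¹ a) hC

variable (G) in
/-- `M₀A(G)`, the vector space of completely bounded Fourier multipliers of `G`. -/
def M0A : Submodule ℂ (G → ℂ) where
  carrier := {φ | ∃ C, MultiplierNormLE φ C}
  zero_mem' := ⟨_, by simpa using MultiplierNormLE.one.smul (0 : ℂ)⟩
  add_mem' := fun ⟨_, h⟩ ⟨_, k⟩ => ⟨_, h.add k⟩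
  smul_mem' := fun c _ ⟨_, h⟩ => ⟨_, h.smul c⟩

/-- The norm `‖φ‖_{M₀A(G)} = ‖M_φ‖_cb`. -/
def multiplierNorm (φ : M0A G) : ℝ := sInf {C | MultiplierNormLE (φ : G → ℂ) C}

/-- The left translate `(L_g φ)(h) = φ(g⁻¹ h)` of a completely bounded Fourier multiplier. -/
def leftTranslate (g : G) (φ : M0A G) : M0A G :=
  ⟨fun h => (φ : G → ℂ) (g⁻¹ * h), φ.2.imp fun _ h => h.translate g⟩

variable (G) in
/-- The constant function `1` as a completely bounded Fourier multiplier. -/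
def oneM0A : M0A G := ⟨1, 1, MultiplierNormLE.one⟩

variable (G) in
theorem exists_ne_zero_L2 : ∃ ξ : L2 G, ξ ≠ 0 := by
  obtain ⟨K, hK, h1⟩ := exists_compact_mem_nhds (1 : G)
  set U := interior K with hU
  have hU0 : (Measure.haar : Measure G) U ≠ 0 :=
    (isOpen_interior.measure_pos _ ⟨1, mem_interior_iff_mem_nhds.2 h1⟩).ne'
  have hUt : (Measure.haar : Measure G) U ≠ ∞ :=
    ((measure_mono interior_subset).trans_lt hK.measure_lt_top).ne
  refine ⟨indicatorConstLp 2 isOpen_interior.measurableSet hUt (1 : ℂ), fun h => ?_⟩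
  have h2 := norm_indicatorConstLp (p := 2) (μ := (Measure.haar : Measure G)) (by norm_num)
    (by norm_num) (hs := isOpen_interior.measurableSet) (hμs := hUt) (c := (1 : ℂ))
  rw [h, norm_zero, norm_one, one_mul] at h2
  have h3 : 0 < (Measure.haar : Measure G).real U := ENNReal.toReal_pos hU0 hUt
  exact (Real.rpow_pos_of_pos h3 _).ne h2

theorem MultiplierNormLE.norm_apply_le {φ : G → ℂ} {C : ℝ} (hφ : MultiplierNormLE φ C) (g : G) :
    ‖φ g‖ ≤ C := by
  obtain ⟨hC, M, hM, hMC⟩ := hφ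
  have h1 := hMC 1 (Matrix.diagonal fun _ => leftRegularLG g)
  have h2 : matrixNorm (Matrix.diagonal fun _ : Fin 1 => leftRegularLG g) ≤ 1 := by
    refine le_trans (le_of_eq ?_) (norm_diagonal_leftRegular_le 1 g)
    unfold matrixNorm
    rw [Matrix.diagonal_map rfl]
    rfl
  have h3 : ‖φ g • leftRegular g‖ ≤
      matrixNorm ((Matrix.diagonal fun _ : Fin 1 => leftRegularLG g).map M) := by
    refine le_trans (le_of_eq ?_) (CStarMatrix.norm_entry_le_norm (i := (0 : Fin 1))
      (j := (0 : Fin 1)))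
    have h := congrArg (Subtype.val) (hM.map_leftRegular g)
    exact congrArg norm h.symm
  obtain ⟨ξ, hξ⟩ := exists_ne_zero_L2 G
  have h4 := (φ g • leftRegular g).le_opNorm ξ
  rw [smul_apply, norm_smul, norm_leftRegular_apply] at h4
  have h5 := le_of_mul_le_mul_right h4 (norm_pos_iff.2 hξ)
  nlinarith

theorem continuous_leftRegular_apply (ξ : L2 G) : Continuous fun g : G => leftRegular g ξ := by
  let F : C(G, C(G, G)) := (ContinuousMap.mk (fun a : G × G => a.1⁻¹ * a.2) (by fun_prop)).curry
  exact (continuous_const (y := ξ)).compMeasurePreservingLp F.continuous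
    (fun g => measurePreserving_mul_left (Measure.haar : Measure G) g⁻¹) (by norm_num)

theorem continuous_leftRegularLG :
    Continuous[inferInstance, ultraweakTopology G] (leftRegularLG (G := G)) := by
  refine (continuous_ultraweak_iff _ _).2 fun ξ η => ?_
  refine continuous_tsum (fun n => ?_) (summable_norm_mul ξ η) fun n g => ?_
  · exact continuous_const.inner (continuous_leftRegular_apply (ξ n))
  · refine (norm_inner_le_norm _ _).trans (le_of_eq ?_)
    rw [← norm_leftRegular_apply g (ξ n)]
    rfl

theorem MultiplierNormLE.continuous {φ : G → ℂ} {C : ℝ} (hφ : MultiplierNormLE φ C) :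
    Continuous φ := by
  obtain ⟨-, M, hM, -⟩ := hφ
  obtain ⟨ζ, hζ⟩ := exists_ne_zero_L2 G
  have key (ξ η : SqSeq G) :
      Continuous fun g => φ g * ultraweakFunctional ξ η (leftRegularLG g) := by
    have h := @Continuous.comp _ _ _ _ (ultraweakTopology G) _ _ _
      ((continuous_ultraweak_iff _ _).1 hM.normal ξ η) continuous_leftRegularLG
    simpa only [Function.comp_def, hM.map_leftRegular, ultraweakFunctional_smul] using h
  refine continuous_iff_continuousAt.2 fun g₀ => ?_
  let ξ : SqSeq G := lp.single 2 0 ζ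
  let η : SqSeq G := lp.single 2 0 (leftRegular g₀ ζ)
  have h0 : ultraweakFunctional ξ η (leftRegularLG g₀) ≠ 0 := by
    have : ultraweakFunctional ξ η (leftRegularLG g₀) =
        inner ℂ (leftRegular g₀ ζ) (leftRegular g₀ ζ) := by
      unfold ultraweakFunctional
      rw [tsum_eq_single 0 fun n hn => ?_]
      · simp [ξ, η, leftRegularLG]
      · simp [ξ, hn]
    rw [this, inner_self_ne_zero, ← norm_ne_zero_iff, norm_leftRegular_apply]
    exact norm_ne_zero_iff.2 hζ
  have h1 : ContinuousAt (fun g => ultraweakFunctional ξ η (leftRegularLG g)) g₀ :=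
    Continuous.continuousAt (@Continuous.comp _ _ _ _ (ultraweakTopology G) _ _ _
      (continuous_ultraweakFunctional ξ η) continuous_leftRegularLG)
  have h2 := (key ξ η).continuousAt.div h1 h0
  refine h2.congr ?_
  filter_upwards [h1.eventually_ne h0] with g hg
  exact mul_div_cancel_right₀ _ hg

theorem continuous_M0A (φ : M0A G) : Continuous (φ : G → ℂ) := φ.2.elim fun _ h => h.continuous

theorem multiplierNorm_nonneg (φ : M0A G) : 0 ≤ multiplierNorm φ :=
  Real.sInf_nonneg fun _ h => h.1

theorem norm_apply_le_multiplierNorm (φ : M0A G) (g : G) : ‖(φ : G → ℂ) g‖ ≤ multiplierNorm φ :=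
  le_csInf φ.2 fun _ h => h.norm_apply_le g

theorem multiplierNorm_smul_le (c : ℂ) (φ : M0A G) :
    multiplierNorm (c • φ) ≤ ‖c‖ * multiplierNorm φ := by
  have hb : BddBelow {C | MultiplierNormLE ((c • φ : M0A G) : G → ℂ) C} := ⟨0, fun _ h => h.1⟩
  rcases eq_or_ne c 0 with rfl | hc
  · obtain ⟨C, h⟩ := φ.2
    refine (csInf_le hb (h.smul 0)).trans ?_
    simp
  · have hc' := norm_pos_iff.2 hc
    rw [mul_comm, ← div_le_iff₀ hc']
    refine le_csInf φ.2 fun C h => ?_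
    rw [div_le_iff₀ hc', mul_comm]
    exact csInf_le hb (h.smul c)

/-! ### The predual of `M₀A(G)` and the weak* topology -/

variable (G) in
/-- The vector space `L¹(G)`, to be normed as a space of functionals on `M₀A(G)`. -/
def PreL1 : Type u := Lp ℂ 1 (Measure.haar : Measure G)

instance : AddCommGroup (PreL1 G) :=
  inferInstanceAs (AddCommGroup (Lp ℂ 1 (Measure.haar : Measure G)))

instance : Module ℂ (PreL1 G) :=
  inferInstanceAs (Module ℂ (Lp ℂ 1 (Measure.haar : Measure G)))

/-- An element of `PreL1 G` as an integrable function. -/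
def PreL1.toLp (f : PreL1 G) : Lp ℂ 1 (Measure.haar : Measure G) := f

/-- The pairing `⟨f, φ⟩ = ∫ f(g) φ(g) dg`. -/
def pairing (f : PreL1 G) (φ : M0A G) : ℂ :=
  ∫ g, f.toLp g * (φ : G → ℂ) g ∂(Measure.haar : Measure G)

theorem integrable_pairing (f : PreL1 G) (φ : M0A G) :
    Integrable (fun g => f.toLp g * (φ : G → ℂ) g) (Measure.haar : Measure G) :=
  (L1.integrable_coeFn f.toLp).mul_bdd (c := multiplierNorm φ)
    (continuous_M0A φ).aestronglyMeasurable
    (Eventually.of_forall (norm_apply_le_multiplierNorm φ))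

theorem pairing_add (f₁ f₂ : PreL1 G) (φ : M0A G) :
    pairing (f₁ + f₂) φ = pairing f₁ φ + pairing f₂ φ := by
  unfold pairing
  rw [← integral_add (integrable_pairing f₁ φ) (integrable_pairing f₂ φ)]
  refine integral_congr_ae ?_
  filter_upwards [Lp.coeFn_add f₁.toLp f₂.toLp] with g hg
  change (f₁.toLp + f₂.toLp : Lp ℂ 1 (Measure.haar : Measure G)) g * _ = _
  rw [hg, Pi.add_apply, add_mul]

theorem pairing_smul (c : ℂ) (f : PreL1 G) (φ : M0A G) :
    pairing (c • f) φ = c * pairing f φ := by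
  unfold pairing
  rw [← integral_const_mul]
  refine integral_congr_ae ?_
  filter_upwards [Lp.coeFn_smul c f.toLp] with g hg
  change (c • f.toLp : Lp ℂ 1 (Measure.haar : Measure G)) g * _ = _
  rw [hg, Pi.smul_apply, smul_eq_mul, mul_assoc]

theorem pairing_smul_right (c : ℂ) (f : PreL1 G) (φ : M0A G) :
    pairing f (c • φ) = c * pairing f φ := by
  unfold pairing
  rw [← integral_const_mul]
  refine integral_congr_ae (Eventually.of_forall fun g => ?_)
  change f.toLp g * (c * (φ : G → ℂ) g) = _
  ring

theorem norm_pairing_le (f : PreL1 G) (φ : M0A G) :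
    ‖pairing f φ‖ ≤ ‖f.toLp‖ * multiplierNorm φ := by
  rw [L1.norm_eq_integral_norm, ← integral_mul_const]
  refine norm_integral_le_of_norm_le ((L1.integrable_coeFn f.toLp).norm.mul_const _)
    (Eventually.of_forall fun g => ?_)
  rw [norm_mul]
  exact mul_le_mul_of_nonneg_left (norm_apply_le_multiplierNorm φ g) (norm_nonneg _)

variable (G) in
/-- The unit ball of `M₀A(G)`. -/
abbrev UnitBall : Type u := {φ : M0A G // multiplierNorm φ ≤ 1}

instance : Nonempty (UnitBall G) := by
  refine ⟨⟨(0 : ℂ) • oneM0A G, (multiplierNorm_smul_le _ _).trans ?_⟩⟩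
  simp

/-- The norm `‖f‖ = sup {|⟨f, φ⟩| : φ ∈ M₀A(G), ‖φ‖_{M₀A(G)} ≤ 1}` on `L¹(G)`. -/
instance : Norm (PreL1 G) := ⟨fun f => ⨆ φ : UnitBall G, ‖pairing f φ.1‖⟩

theorem bddAbove_pairing (f : PreL1 G) :
    BddAbove (Set.range fun φ : UnitBall G => ‖pairing f φ.1‖) := by
  refine ⟨‖f.toLp‖, ?_⟩
  rintro _ ⟨φ, rfl⟩
  exact (norm_pairing_le f φ.1).trans (mul_le_of_le_one_right (norm_nonneg _) φ.2)

theorem norm_pairing_le_of_unitBall (f : PreL1 G) (φ : UnitBall G) : ‖pairing f φ.1‖ ≤ ‖f‖ :=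
  le_ciSup (bddAbove_pairing f) φ

theorem preL1_core : SeminormedSpace.Core ℂ (PreL1 G) where
  norm_nonneg _ := Real.iSup_nonneg fun _ => norm_nonneg _
  norm_smul c f := by
    change (⨆ φ : UnitBall G, ‖pairing (c • f) φ.1‖) = ‖c‖ * ⨆ φ : UnitBall G, ‖pairing f φ.1‖
    rw [Real.mul_iSup_of_nonneg (norm_nonneg c)]
    simp only [pairing_smul, norm_mul]
  norm_triangle f₁ f₂ := by
    refine ciSup_le fun φ => ?_
    rw [pairing_add]
    exact (norm_add_le _ _).trans
      (add_le_add (norm_pairing_le_of_unitBall f₁ φ) (norm_pairing_le_of_unitBall f₂ φ))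

instance : SeminormedAddCommGroup (PreL1 G) := SeminormedAddCommGroup.ofCore preL1_core

instance : NormedSpace ℂ (PreL1 G) where
  norm_smul_le c f := (preL1_core.norm_smul c f).le

theorem norm_pairing_le' (f : PreL1 G) (φ : M0A G) : ‖pairing f φ‖ ≤ multiplierNorm φ * ‖f‖ := by
  rcases (multiplierNorm_nonneg φ).eq_or_lt with h | h
  · have := norm_pairing_le f φ
    rw [← h] at this ⊢
    simpa using this
  · have hc : ‖((multiplierNorm φ : ℂ))⁻¹‖ = (multiplierNorm φ)⁻¹ := by
      rw [norm_inv, Complex.norm_real, Real.norm_of_nonneg h.le]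
    have h1 : multiplierNorm ((multiplierNorm φ : ℂ)⁻¹ • φ) ≤ 1 := by
      refine (multiplierNorm_smul_le _ _).trans ?_
      rw [hc, inv_mul_cancel₀ h.ne']
    have h2 := norm_pairing_le_of_unitBall f ⟨_, h1⟩
    rw [pairing_smul_right, norm_mul, hc] at h2
    rwa [inv_mul_le_iff₀ h] at h2

/-- `φ ∈ M₀A(G)` as a bounded linear functional on `L¹(G)` with the above norm. -/
def functional (φ : M0A G) : PreL1 G →L[ℂ] ℂ :=
  LinearMap.mkContinuous
    { toFun := fun f => pairing f φ
      map_add' := fun f₁ f₂ => pairing_add f₁ f₂ φ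
      map_smul' := fun c f => pairing_smul c f φ } (multiplierNorm φ) fun f => norm_pairing_le' f φ

variable (G) in
/-- The predual `M₀A(G)_*`: the completion of `L¹(G)` in the above norm. -/
abbrev Predual : Type u := UniformSpace.Completion (PreL1 G)

/-- The duality between `M₀A(G)` and its predual: the continuous extension of `⟨·, φ⟩`. -/
def duality (φ : M0A G) : Predual G → ℂ := UniformSpace.Completion.extension (functional φ)

variable (G) in
/-- The weak* topology on `M₀A(G)`: pointwise convergence on the predual. -/
@[reducible] def weakStarTopology : TopologicalSpace (M0A G) :=
  TopologicalSpace.induced duality Pi.topologicalSpace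

/-! ### The Approximation Property and property (T*) -/

variable (G) in
/-- The Fourier algebra `A(G)`: the coefficients of the left regular representation. -/
def fourierAlgebra : Set (G → ℂ) :=
  {φ | ∃ ξ η : L2 G, ∀ g, φ g = inner ℂ η (leftRegular g ξ)}

variable (G) in
/-- The Approximation Property: there is a net in `A(G) ⊆ M₀A(G)` converging to `1` in the weak*
topology of `M₀A(G)`. -/
def HasAP : Prop :=
  ∃ (ι : Type u) (_ : Preorder ι) (_ : IsDirectedOrder ι) (_ : Nonempty ι) (φ : ι → M0A G),
    (∀ α, (φ α : G → ℂ) ∈ fourierAlgebra G) ∧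
      Tendsto φ atTop (@nhds _ (weakStarTopology G) (oneM0A G))

/-- A left invariant mean on `M₀A(G)`: a positive linear functional `m` with `‖m‖ = m(1) = 1` for
the supremum norm, such that `m(L_g φ) = m(φ)`. -/
structure IsLeftInvariantMean (m : M0A G →ₗ[ℂ] ℂ) : Prop where
  nonneg : ∀ φ : M0A G, (∀ g, 0 ≤ (φ : G → ℂ) g) → 0 ≤ m φ
  norm_le : ∀ (φ : M0A G) (C : ℝ), (∀ g, ‖(φ : G → ℂ) g‖ ≤ C) → ‖m φ‖ ≤ C
  map_one : m (oneM0A G) = 1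
  left_invariant : ∀ (g : G) (φ : M0A G), m (leftTranslate g φ) = m φ

variable (G) in
/-- Property (T*): the left invariant mean on `M₀A(G)` is weak* continuous. (There is exactly one
left invariant mean on `M₀A(G)`; the definition does not presuppose this.) -/
def PropertyTStar : Prop :=
  ∃ m : M0A G →ₗ[ℂ] ℂ, IsLeftInvariantMean m ∧ Continuous[weakStarTopology G, inferInstance] m

end Basic

end APObstruction

end

/-! Weak* continuity forces the mean to respect the limit in the AP, and noncompactness makes that
limit impossible. Coefficients of the regular representation vanish at infinity: when ξ and η have
compact supports K and L, the coefficient is zero off L K⁻¹, and density of such vectors gives the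
general case.

On a noncompact group an invariant mean m kills every multiplier φ vanishing at infinity. If |φ| ≤ ε
off a compact K, choose n translates of K that are pairwise disjoint. At each point at most one of
the corresponding translates of φ exceeds ε in modulus, so their sum has supremum norm at most ‖φ‖ +
nε, while m of the sum is n m(φ). Dividing by n and letting n grow gives |m(φ)| ≤ ε.

So m is 0 along a net in A(G) that converges weak* to 1, whereas m(1) = 1. -/

/-! ### Disjoint translates and compactly supported approximation -/

open Pointwise in
/-- In a noncompact group, every compact set has infinitely many pairwise disjoint translates. -/
theorem exists_seq_pairwise_disjoint_smul {G : Type*} [Group G] [TopologicalSpace G]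
    [IsTopologicalGroup G] [NoncompactSpace G] {K : Set G} (hK : IsCompact K) :
    ∃ u : ℕ → G, Pairwise fun i j => Disjoint (u i • K) (u j • K) := by
  -- The greedy choice only makes each new translate disjoint from the earlier ones; symmetry
  -- upgrades this to all pairs.
  have : Std.Symm fun x y : G => Disjoint (x • K) (y • K) := ⟨fun _ _ h => h.symm⟩
  obtain ⟨u, -, hu⟩ := exists_seq_of_forall_finset_exists' (fun _ : G => True)
    (fun x y => Disjoint (x • K) (y • K)) fun s _ => by
      -- The translates chosen so far have compact union, so noncompactness leaves room to move K
      -- off it.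
      have hc : IsCompact (⋃ x ∈ s, x • K) := s.isCompact_biUnion fun x _ => hK.smul x
      obtain ⟨g, hg⟩ := exists_disjoint_smul_of_isCompact hc hK
      exact ⟨g, trivial, fun x hx => hg.mono_left (Set.subset_biUnion_of_mem (u := (· • K)) hx)⟩
  exact ⟨u, hu⟩

open scoped NNReal in
/-- The compactly supported functions are dense in `Lᵖ` for a regular measure. Normality of the
space is not needed, since the approximating functions need not be continuous. -/
theorem exists_hasCompactSupport_memLp_eLpNorm_sub_le {X E : Type*} [TopologicalSpace X] [R1Space X]
    [MeasurableSpace X] [BorelSpace X] [NormedAddCommGroup E] {μ : Measure X} [μ.Regular]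
    {p : ℝ≥0∞} (hp : p ≠ ∞) {f : X → E} (hf : MemLp f p μ) {ε : ℝ≥0∞} (hε : ε ≠ 0) :
    ∃ g : X → E, eLpNorm (f - g) p μ ≤ ε ∧ MemLp g p μ ∧ HasCompactSupport g := by
  -- By density of simple functions, only indicators of measurable sets of finite measure remain,
  -- once closure under sums is checked.
  apply hf.induction_dense hp _ _ _ _ hε
  rotate_left
  · rintro f g ⟨hf, hfs⟩ ⟨hg, hgs⟩
    exact ⟨hf.add hg, hfs.add hgs⟩
  · rintro f ⟨hf, -⟩
    exact hf.aestronglyMeasurable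
  intro c t ht htμ ε hε
  obtain ⟨δ, hδ0, hδ⟩ : ∃ δ : ℝ≥0, 0 < δ ∧
      ∀ s : Set X, μ s ≤ δ → eLpNorm (s.indicator fun _ => c) p μ ≤ ε :=
    exists_eLpNorm_indicator_le hp c hε
  -- Inner regularity: `t` is exhausted by a compact `s` up to measure δ. Taking `s` closed as well
  -- makes it measurable without a Hausdorff assumption.
  obtain ⟨s, hst, hs, hsc, hμ⟩ :=
    ht.exists_isCompact_isClosed_sdiff_lt htμ.ne (ENNReal.coe_pos.2 hδ0).ne'
  refine ⟨s.indicator fun _ => c, ?_, ?_, ?_⟩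
  · rw [← eLpNorm_neg, neg_sub, ← Set.indicator_sdiff hst]
    exact hδ _ hμ.le
  · exact memLp_indicator_const p hsc.measurableSet c (Or.inr ((measure_mono hst).trans_lt htμ).ne)
  · exact HasCompactSupport.intro hs fun x hx => Set.indicator_of_notMem hx _

/-! ### The Fourier algebra vanishes at infinity -/

namespace APObstruction

variable {G : Type*} [Group G] [TopologicalSpace G] [IsTopologicalGroup G] [LocallyCompactSpace G]
  [MeasurableSpace G] [BorelSpace G]

/-- The compactly supported functions are dense in `L²(G)`. -/
theorem exists_L2_norm_sub_le_of_pos (ξ : L2 G) {ε : ℝ} (hε : 0 < ε) :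
    ∃ ξ' : L2 G, ‖ξ - ξ'‖ ≤ ε ∧ ∃ K : Set G, IsCompact K ∧
      ∀ᵐ h ∂(Measure.haar : Measure G), h ∉ K → ξ' h = 0 := by
  obtain ⟨f, hf, hfm, hfs⟩ := exists_hasCompactSupport_memLp_eLpNorm_sub_le (by norm_num)
    (Lp.memLp ξ) (ε := ENNReal.ofReal ε) (by simpa using hε)
  refine ⟨hfm.toLp f, ?_, tsupport f, hfs, ?_⟩
  · rw [Lp.norm_def]
    refine ENNReal.toReal_le_of_le_ofReal hε.le (le_trans (le_of_eq (eLpNorm_congr_ae ?_)) hf)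
    filter_upwards [Lp.coeFn_sub ξ (hfm.toLp f), hfm.coeFn_toLp] with h h1 h2
    rw [h1, Pi.sub_apply, Pi.sub_apply, h2]
  · filter_upwards [hfm.coeFn_toLp] with h h1 h2
    rw [h1, image_eq_zero_of_notMem_tsupport h2]

-- The integrand at h is nonzero only if h ∈ L and g⁻¹h ∈ K, and then g = h (g⁻¹h)⁻¹ lies in L K⁻¹.
open Pointwise in
theorem inner_leftRegular_eq_zero {ξ η : L2 G} {K L : Set G}
    (hξ : ∀ᵐ h ∂(Measure.haar : Measure G), h ∉ K → ξ h = 0)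
    (hη : ∀ᵐ h ∂(Measure.haar : Measure G), h ∉ L → η h = 0) {g : G} (hg : g ∉ L * K⁻¹) :
    inner ℂ η (leftRegular g ξ) = 0 := by
  rw [L2.inner_def]
  refine integral_eq_zero_of_ae ?_
  have h1 := (measurePreserving_mul_left (Measure.haar : Measure G) g⁻¹).quasiMeasurePreserving.ae hξ
  filter_upwards [leftRegular_ae g ξ, hη, h1] with h a b c
  rw [a, Pi.zero_apply]
  by_cases hL : h ∈ L
  · rw [c fun hK => hg ?_, inner_zero_right]
    exact ⟨h, hL, h⁻¹ * g, by simpa using hK, by simp⟩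
  · rw [b hL, inner_zero_left]

/-- The functions in the Fourier algebra vanish at infinity. -/
theorem exists_isCompact_norm_le_of_mem_fourierAlgebra {φ : G → ℂ} (hφ : φ ∈ fourierAlgebra G)
    {ε : ℝ} (hε : 0 < ε) : ∃ K : Set G, IsCompact K ∧ ∀ g ∉ K, ‖φ g‖ ≤ ε := by
  obtain ⟨ξ, η, h⟩ := hφ
  -- Each of the two approximation errors gets ε / 2; the + 1 keeps the denominator positive when
  -- the vector is zero.
  have hδ : 0 < ε / 2 / (‖η‖ + 1) := by positivity
  obtain ⟨ξ', hξ, K, hK, hξK⟩ := exists_L2_norm_sub_le_of_pos ξ hδ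
  -- The tolerance for η depends on ‖ξ'‖, so ξ' has to be chosen first.
  have hδ' : 0 < ε / 2 / (‖ξ'‖ + 1) := by positivity
  obtain ⟨η', hη, L, hL, hηL⟩ := exists_L2_norm_sub_le_of_pos η hδ'
  refine ⟨_, hL.mul hK.inv, fun g hg => ?_⟩
  -- The omitted term ⟨λ(g) ξ', η'⟩ vanishes because g ∉ L K⁻¹.
  have key : φ g = inner ℂ η (leftRegular g (ξ - ξ')) + inner ℂ (η - η') (leftRegular g ξ') := by
    rw [h, map_sub, inner_sub_right, inner_sub_left, inner_leftRegular_eq_zero hξK hηL hg]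
    ring
  have h1 : ‖inner ℂ η (leftRegular g (ξ - ξ'))‖ ≤ ε / 2 := by
    refine (norm_inner_le_norm _ _).trans ?_
    rw [norm_leftRegular_apply]
    rw [le_div_iff₀ (by positivity)] at hξ
    nlinarith [norm_nonneg (ξ - ξ')]
  have h2 : ‖inner ℂ (η - η') (leftRegular g ξ')‖ ≤ ε / 2 := by
    refine (norm_inner_le_norm _ _).trans ?_
    rw [norm_leftRegular_apply]
    rw [le_div_iff₀ (by positivity)] at hη
    nlinarith [norm_nonneg (η - η')]
  rw [key]
  exact (norm_add_le _ _).trans (by linarith)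

/-! ### Invariant means on a noncompact group -/

theorem sum_leftTranslate_apply {n : ℕ} (u : ℕ → G) (φ : M0A G) (h : G) :
    ((∑ i ∈ Finset.range n, leftTranslate (u i) φ : M0A G) : G → ℂ) h =
      ∑ i ∈ Finset.range n, (φ : G → ℂ) ((u i)⁻¹ * h) := by
  rw [Submodule.coe_sum, Finset.sum_apply]
  rfl

open Pointwise in
/-- A left invariant mean vanishes on the functions that vanish at infinity, if the group is not
compact. -/
theorem IsLeftInvariantMean.eq_zero [NoncompactSpace G] {m : M0A G →ₗ[ℂ] ℂ}
    (hm : IsLeftInvariantMean m) {φ : M0A G}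
    (hφ : ∀ ε : ℝ, 0 < ε → ∃ K : Set G, IsCompact K ∧ ∀ g ∉ K, ‖(φ : G → ℂ) g‖ ≤ ε) :
    m φ = 0 := by
  rw [← norm_le_zero_iff]
  refine le_of_forall_pos_le_add fun ε hε => ?_
  obtain ⟨K, hK, hφK⟩ := hφ ε hε
  obtain ⟨u, hu⟩ := exists_seq_pairwise_disjoint_smul hK
  -- `multiplierNorm φ` serves only as a bound for |φ| that does not depend on n.
  have bound (n : ℕ) : n * ‖m φ‖ ≤ multiplierNorm φ + n * ε := by
    have h1 : m (∑ i ∈ Finset.range n, leftTranslate (u i) φ) = n * m φ := by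
      simp [map_sum, hm.left_invariant]
    have h2 := hm.norm_le (∑ i ∈ Finset.range n, leftTranslate (u i) φ)
      (multiplierNorm φ + n * ε) fun h => by
        rw [sum_leftTranslate_apply]
        refine (norm_sum_le _ _).trans ?_
        have h0 := multiplierNorm_nonneg φ
        -- If h lies in the j-th translate of K, disjointness keeps it out of the others, so only
        -- the j-th term can exceed ε.
        by_cases hex : ∃ j ∈ Finset.range n, h ∈ u j • K
        · obtain ⟨j, hj, hjK⟩ := hex
          rw [← Finset.add_sum_erase _ _ hj]
          refine add_le_add (norm_apply_le_multiplierNorm φ _) ?_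
          refine (Finset.sum_le_card_nsmul _ _ ε fun i hi => hφK _ fun hiK => ?_).trans ?_
          · exact Set.disjoint_left.1 (hu (Finset.ne_of_mem_erase hi))
              (Set.mem_smul_set_iff_inv_smul_mem.2 hiK) hjK
          · rw [nsmul_eq_mul]
            refine mul_le_mul_of_nonneg_right ?_ hε.le
            -- The n - 1 remaining terms are counted as n, which is harmless and makes both cases
            -- give the same bound.
            exact_mod_cast (Finset.card_erase_le).trans (Finset.card_range n).le
        · refine (Finset.sum_le_card_nsmul _ _ ε fun i hi => hφK _ fun hiK => ?_).trans ?_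
          · exact hex ⟨i, hi, Set.mem_smul_set_iff_inv_smul_mem.2 hiK⟩
          · rw [nsmul_eq_mul, Finset.card_range]
            exact le_add_of_nonneg_left h0
    rwa [h1, norm_mul, Complex.norm_natCast] at h2
  rw [zero_add]
  by_contra! hlt
  -- For ‖m φ‖ > ε the bound reads n (‖m φ‖ - ε) ≤ `multiplierNorm φ` for all n, which fails for
  -- large n.
  obtain ⟨n, hn⟩ := exists_nat_gt (multiplierNorm φ / (‖m φ‖ - ε))
  rw [div_lt_iff₀ (sub_pos.2 hlt)] at hn
  linarith [bound n]

end APObstruction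

/-! ### The contradiction between the AP and property (T*) -/

theorem mainTheorem6 {G : Type*} [Group G] [TopologicalSpace G] [IsTopologicalGroup G]
    [LocallyCompactSpace G] [T2Space G] [MeasurableSpace G] [BorelSpace G]
    (hAP : APObstruction.HasAP G) (hT : APObstruction.PropertyTStar G) : CompactSpace G := by
  by_contra hG
  have : NoncompactSpace G := not_compactSpace_iff.1 hG
  obtain ⟨ι, _, _, _, φ, hφ, hlim⟩ := hAP
  obtain ⟨m, hm, hmc⟩ := hT
  have h1 : Tendsto (fun α => m (φ α)) atTop (𝓝 (m (APObstruction.oneM0A G))) :=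
    (@Continuous.tendsto _ _ (APObstruction.weakStarTopology G) _ _ hmc _).comp hlim
  have h2 (α : ι) : m (φ α) = 0 := hm.eq_zero fun _ hε =>
    APObstruction.exists_isCompact_norm_le_of_mem_fourierAlgebra (hφ α) hε
  simp only [h2, hm.map_one] at h1
  -- The net m(φ α) is constantly 0 yet tends to m(1) = 1.
  exact zero_ne_one (tendsto_nhds_unique tendsto_const_nhds h1)
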